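/- Let $p\ge 1$ and $n\ge 2$, and let $\mathbf x_1,\dots,\mathbf x_n$ be an i.i.d. random sample from a $p$-variate elliptical distribution $\mathcal E_p(\boldsymbol\mu,\mathbf M,g)$ with finite fourth order moments, i.e. from a distribution on $\mathbb R^p$ with density $C\,|\mathbf M|^{-1/2}\,g\big((\mathbf x-\boldsymbol\mu)^\top\mathbf M^{-1}(\mathbf x-\boldsymbol\mu)\big)$, where $g:[0,\infty)\to[0,\infty)$ is measurable, $C>0$ is a normalizing constant, $\boldsymbol\mu$ is the mean vector and the positive definite matrix $\mathbf M$ is the covariance matrix of the distribution. Let $\bar{\mathbf x}=\frac1n\sum_{i=1}^n\mathbf x_i$ and let $\mathbf S=\frac1{n-1}\sum_{i=1}^n(\mathbf x_i-\bar{\mathbf x})(\mathbf x_i-\bar{\mathbf x})^\top$ be the sample covariance matrix. Put $$\gamma=\frac{p\,\mathrm{tr}(\mathbf M^2)}{\mathrm{tr}(\mathbf M)^2},\qquad \kappa=\frac{\mathbb E[r^4]}{p(p+2)}-1,\qquad r^2=(\mathbf x-\boldsymbol\mu)^\top\mathbf M^{-1}(\mathbf x-\boldsymbol\mu),\quad \mathbf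 x\sim\mathcal E_p(\boldsymbol\mu,\mathbf M,g).$$ Then $\|\mathbf S-\mathbf M\|_{\mathrm F}^2$ is integrable, and the mean squared error $\mathrm{MSE}(\mathbf S)=\mathbb E\big[\|\mathbf S-\mathbf M\|_{\mathrm F}^2\big]$ and the normalized mean squared error $\mathrm{NMSE}(\mathbf S)=\mathrm{MSE}(\mathbf S)/\|\mathbf M\|_{\mathrm F}^2$ are $$\mathrm{MSE}(\mathbf S)=\Big(\frac1{n-1}+\frac\kappa n\Big)\mathrm{tr}(\mathbf M)^2+\Big(\frac1{n-1}+\frac{2\kappa}n\Big)\mathrm{tr}(\mathbf M^2),$$ $$\mathrm{NMSE}(\mathbf S)=\Big(1+\frac p\gamma\Big)\Big(\frac1{n-1}+\frac\kappa n\Big)+\frac\kappa n.$$ -/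

import Mathlib

open MeasureTheory ProbabilityTheory Matrix
open scoped NNReal ENNReal

noncomputable section

/-- The squared Mahalanobis distance `(x - μ)ᵀ M⁻¹ (x - μ)`. -/
def mahalanobisSq {p : ℕ} (μ : Fin p → ℝ) (M : Matrix (Fin p) (Fin p) ℝ) (x : Fin p → ℝ) : ℝ :=
  (x - μ) ⬝ᵥ (M⁻¹ *ᵥ (x - μ))

/-- The function `C |M|^{-1/2} g((x - μ)ᵀ M⁻¹ (x - μ))` of `x`. For positive definite `M` the
quadratic form is nonnegative, so that `Real.toNNReal` does not change it. -/
def ellipticalDensity {p : ℕ} (C : ℝ) (μ : Fin p → ℝ) (M : Matrix (Fin p) (Fin p) ℝ)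
    (g : ℝ≥0 → ℝ≥0) (x : Fin p → ℝ) : ℝ :=
  C * (Real.sqrt M.det)⁻¹ * (g (Real.toNNReal (mahalanobisSq μ M x)) : ℝ)

/-- `P` is the elliptical distribution `E_p(μ, M, g)` on `ℝ^p`: the matrix `M` is positive definite,
`P` has the density `C |M|^{-1/2} g((x - μ)ᵀ M⁻¹ (x - μ))` with respect to Lebesgue measure for a
normalizing constant `C`, and the density generator `g` is scaled so that `M` is the covariance
matrix of `P` (and `μ` is its mean vector). -/
structure IsElliptical {p : ℕ} (P : Measure (Fin p → ℝ)) (μ : Fin p → ℝ)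
    (M : Matrix (Fin p) (Fin p) ℝ) (g : ℝ≥0 → ℝ≥0) : Prop where
  posDef : M.PosDef
  measurable_generator : Measurable g
  isProbabilityMeasure : IsProbabilityMeasure P
  density : ∃ C : ℝ, 0 < C ∧
    P = volume.withDensity (fun x => ENNReal.ofReal (ellipticalDensity C μ M g x))
  second_moments : ∀ i, MemLp (fun x : Fin p → ℝ => x i) 2 P
  mean : ∀ i, ∫ x, x i ∂P = μ i
  covariance : ∀ i j, ∫ x, (x i - μ i) * (x j - μ j) ∂P = M i j

/-- Finite fourth order moments: every coordinate of `P` has a finite fourth moment (hence so has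
every product of four coordinates). -/
def HasFiniteFourthMoments {p : ℕ} (P : Measure (Fin p → ℝ)) : Prop :=
  ∀ i, MemLp (fun x : Fin p → ℝ => x i) 4 P

/-- The generating variate `r = √((x - μ)ᵀ M⁻¹ (x - μ))`. -/
def generatingVariate {p : ℕ} (μ : Fin p → ℝ) (M : Matrix (Fin p) (Fin p) ℝ)
    (x : Fin p → ℝ) : ℝ :=
  Real.sqrt (mahalanobisSq μ M x)

/-- The elliptical kurtosis parameter `κ = E[r⁴] / (p (p + 2)) - 1`. -/
def ellipticalKurtosis {p : ℕ} (P : Measure (Fin p → ℝ)) (μ : Fin p → ℝ)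
    (M : Matrix (Fin p) (Fin p) ℝ) : ℝ :=
  (∫ x, generatingVariate μ M x ^ 4 ∂P) / ((p : ℝ) * ((p : ℝ) + 2)) - 1

/-- The sphericity `γ = p tr(M²) / tr(M)²`. -/
def sphericity {p : ℕ} (M : Matrix (Fin p) (Fin p) ℝ) : ℝ :=
  (p : ℝ) * (M ^ 2).trace / M.trace ^ 2

/-- The sample mean vector. -/
def sampleMean {n p : ℕ} (x : Fin n → Fin p → ℝ) : Fin p → ℝ :=
  (1 / (n : ℝ)) • ∑ i, x i

/-- The sample covariance matrix `S = (n - 1)⁻¹ ∑ i, (x i - x̄) (x i - x̄)ᵀ`. -/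
def sampleCov {n p : ℕ} (x : Fin n → Fin p → ℝ) : Matrix (Fin p) (Fin p) ℝ :=
  (1 / ((n : ℝ) - 1)) • ∑ i, vecMulVec (x i - sampleMean x) (x i - sampleMean x)

section Frobenius

attribute [local instance] Matrix.frobeniusNormedAddCommGroup

/-- The Frobenius norm of a real matrix. -/
def frobNorm {p : ℕ} (A : Matrix (Fin p) (Fin p) ℝ) : ℝ := ‖A‖

end Frobenius

/-- The mean squared error `E[‖A - M‖_F²]` of a random matrix `A` as an estimator of `M`. -/
def MSE {Ω : Type*} [MeasurableSpace Ω] (ν : Measure Ω) {p : ℕ}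
    (A : Ω → Matrix (Fin p) (Fin p) ℝ) (M : Matrix (Fin p) (Fin p) ℝ) : ℝ :=
  ∫ ω, frobNorm (A ω - M) ^ 2 ∂ν

/-- The normalized mean squared error `E[‖A - M‖_F²] / ‖M‖_F²`. -/
def NMSE {Ω : Type*} [MeasurableSpace Ω] (ν : Measure Ω) {p : ℕ}
    (A : Ω → Matrix (Fin p) (Fin p) ℝ) (M : Matrix (Fin p) (Fin p) ℝ) : ℝ :=
  MSE ν A M / frobNorm M ^ 2

end

/-! The squared Frobenius error is the sum of the squared entry errors, so it suffices to find the
variance of each entry of `S`. Two independent facts give it.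

Fourth moments: the density depends only on the Mahalanobis distance, so reflections preserving the
form of `M⁻¹` preserve `P`. When `u` and `v` have the same `M`-length, such a reflection exchanges
their linear forms. Hence `E (u ⬝ (x - μ))⁴` is a multiple of `(u ⬝ M u)²`; polarization gives the
mixed moments, and computing `E r⁴` identifies the constant as `κ + 1` (`integral_sq_mul_sq`).

Sampling: for any centred features `f`, `h` with fourth moments, the covariance error is a linear
combination of centred products `f (X i) h (X l)`, which are uncorrelated except with themselves and
their transposes (`integral_sq_sum_centeredProd`). -/

namespace Matrix

variable {p : ℕ} {M : Matrix (Fin p) (Fin p) ℝ}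

/-! ### Positive definite matrices and reflections -/

open scoped MatrixOrder in
lemma PosDef.exists_eq_transpose_mul_self (hM : M.PosDef) :
    ∃ B : Matrix (Fin p) (Fin p) ℝ, M = Bᵀ * B := by
  obtain ⟨B, hB⟩ := CStarAlgebra.nonneg_iff_eq_star_mul_self.1 hM.posSemidef.nonneg
  exact ⟨B, by rw [hB, star_eq_conjTranspose, conjTranspose_eq_transpose_of_trivial]⟩

lemma PosDef.transpose_eq (hM : M.PosDef) : Mᵀ = M := by
  simpa [IsHermitian, conjTranspose_eq_transpose_of_trivial] using hM.isHermitian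

lemma dotProduct_mulVec_comm_of_transpose_eq (hM : Mᵀ = M) (u v : Fin p → ℝ) :
    u ⬝ᵥ M *ᵥ v = v ⬝ᵥ M *ᵥ u := by
  rw [dotProduct_mulVec, ← mulVec_transpose, hM, dotProduct_comm]

lemma PosDef.dotProduct_mulVec_self_pos (hM : M.PosDef) {u : Fin p → ℝ} (hu : u ≠ 0) :
    0 < u ⬝ᵥ M *ᵥ u := by
  simpa using hM.dotProduct_mulVec_pos hu

lemma PosDef.inv_mulVec_mulVec (hM : M.PosDef) (u : Fin p → ℝ) : M⁻¹ *ᵥ (M *ᵥ u) = u := by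
  rw [mulVec_mulVec, nonsing_inv_mul _ ((isUnit_iff_isUnit_det _).1 hM.isUnit), one_mulVec]

lemma PosDef.mulVec_inv_mulVec (hM : M.PosDef) (u : Fin p → ℝ) : M *ᵥ (M⁻¹ *ᵥ u) = u := by
  rw [mulVec_mulVec, mul_nonsing_inv _ ((isUnit_iff_isUnit_det _).1 hM.isUnit), one_mulVec]

/-- The reflection `y ↦ y - 2 (w ⬝ y) / (w ⬝ M w) • M w`, which preserves the quadratic form of
`M⁻¹`. -/
noncomputable def mahalanobisReflection (M : Matrix (Fin p) (Fin p) ℝ) (w : Fin p → ℝ) :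
    Matrix (Fin p) (Fin p) ℝ :=
  1 - (2 / (w ⬝ᵥ M *ᵥ w)) • vecMulVec (M *ᵥ w) w

lemma mahalanobisReflection_mulVec (w y : Fin p → ℝ) :
    mahalanobisReflection M w *ᵥ y = y - (2 / (w ⬝ᵥ M *ᵥ w) * (w ⬝ᵥ y)) • M *ᵥ w := by
  ext i
  simp [mahalanobisReflection, sub_mulVec, smul_mulVec, vecMulVec_mulVec]
  ring

lemma mahalanobisReflection_mul_self {w : Fin p → ℝ} (hw : w ⬝ᵥ M *ᵥ w ≠ 0) :
    mahalanobisReflection M w * mahalanobisReflection M w = 1 := by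
  refine ext_of_mulVec_single fun i => ?_
  rw [← mulVec_mulVec]
  generalize (Pi.single i 1 : Fin p → ℝ) = y
  rw [mahalanobisReflection_mulVec, mahalanobisReflection_mulVec, one_mulVec, dotProduct_sub,
    dotProduct_smul, smul_eq_mul]
  ext j
  simp only [Pi.sub_apply, Pi.smul_apply, smul_eq_mul]
  field_simp
  ring

/-- An involution has determinant `±1`; this makes the reflection preserve Lebesgue measure. -/
lemma abs_det_mahalanobisReflection {w : Fin p → ℝ} (hw : w ⬝ᵥ M *ᵥ w ≠ 0) :
    |(mahalanobisReflection M w).det| = 1 := by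
  have h := congrArg det (mahalanobisReflection_mul_self hw)
  rw [det_mul, det_one] at h
  rcases mul_self_eq_one_iff.1 h with h | h <;> simp [h]

lemma PosDef.mahalanobisReflection_quadratic (hM : M.PosDef) {w : Fin p → ℝ}
    (hw : w ⬝ᵥ M *ᵥ w ≠ 0) (y : Fin p → ℝ) :
    (mahalanobisReflection M w *ᵥ y) ⬝ᵥ M⁻¹ *ᵥ (mahalanobisReflection M w *ᵥ y)
      = y ⬝ᵥ M⁻¹ *ᵥ y := by
  have h : (M *ᵥ w) ⬝ᵥ M⁻¹ *ᵥ y = w ⬝ᵥ y := by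
    rw [dotProduct_comm, dotProduct_mulVec_comm_of_transpose_eq hM.transpose_eq,
      hM.mulVec_inv_mulVec]
  rw [mahalanobisReflection_mulVec, mulVec_sub, mulVec_smul, hM.inv_mulVec_mulVec]
  simp only [sub_dotProduct, dotProduct_sub, smul_dotProduct, dotProduct_smul, smul_eq_mul, h,
    dotProduct_comm y w, dotProduct_comm (M *ᵥ w) w]
  field_simp
  ring

/-- The reflection along `u - v` exchanges the linear forms of `u` and `v` when these have the same
length with respect to `M`. -/
lemma PosDef.dotProduct_mahalanobisReflection_mulVec (hM : M.PosDef) {u v : Fin p → ℝ}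
    (huv : u ⬝ᵥ M *ᵥ u = v ⬝ᵥ M *ᵥ v) (hw : (u - v) ⬝ᵥ M *ᵥ (u - v) ≠ 0) (y : Fin p → ℝ) :
    u ⬝ᵥ (mahalanobisReflection M (u - v) *ᵥ y) = v ⬝ᵥ y := by
  have h1 : (u - v) ⬝ᵥ M *ᵥ (u - v) = 2 * (u ⬝ᵥ M *ᵥ (u - v)) := by
    simp only [mulVec_sub, sub_dotProduct, dotProduct_sub, huv,
      dotProduct_mulVec_comm_of_transpose_eq hM.transpose_eq v u]
    ring
  rw [mahalanobisReflection_mulVec, dotProduct_sub, dotProduct_smul, smul_eq_mul]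
  have h2 : 2 / ((u - v) ⬝ᵥ M *ᵥ (u - v)) * (u ⬝ᵥ M *ᵥ (u - v)) = 1 := by
    rw [h1] at hw ⊢
    have : u ⬝ᵥ M *ᵥ (u - v) ≠ 0 := by simpa using hw
    field_simp
  rw [mul_right_comm, h2, sub_dotProduct]
  ring

end Matrix

/-! ### Reflection invariance and fourth moments of elliptical distributions -/

lemma MeasureTheory.MeasurePreserving.withDensity_of_comp_eq {α : Type*} [MeasurableSpace α]
    {m : Measure α} {T : α → α} (hT : MeasurePreserving T m m) {f : α → ℝ≥0∞} (hf : Measurable f)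
    (hfT : ∀ x, f (T x) = f x) : MeasurePreserving T (m.withDensity f) (m.withDensity f) := by
  refine ⟨hT.measurable, Measure.ext fun s hs => ?_⟩
  rw [Measure.map_apply hT.measurable hs, withDensity_apply _ (hT.measurable hs),
    withDensity_apply _ hs, ← hT.setLIntegral_comp_preimage hs hf]
  simp only [hfT]

lemma measurePreserving_mulVec_of_abs_det_eq_one {p : ℕ} {A : Matrix (Fin p) (Fin p) ℝ}
    (hA : |A.det| = 1) : MeasurePreserving (fun x : Fin p → ℝ => A *ᵥ x) := by
  refine ⟨by fun_prop, ?_⟩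
  have h := Real.map_matrix_volume_pi_eq_smul_volume_pi (M := A) (by rintro h; simp [h] at hA)
  rwa [abs_inv, hA, inv_one, ENNReal.ofReal_one, one_smul] at h

lemma measurable_mahalanobisSq {p : ℕ} (μ : Fin p → ℝ) (M : Matrix (Fin p) (Fin p) ℝ) :
    Measurable (mahalanobisSq μ M) := by
  unfold mahalanobisSq
  fun_prop

namespace IsElliptical

variable {p : ℕ} {P : Measure (Fin p → ℝ)} {μ : Fin p → ℝ} {M : Matrix (Fin p) (Fin p) ℝ}
  {g : ℝ≥0 → ℝ≥0}

lemma measurePreserving_reflection (hP : IsElliptical P μ M g) {w : Fin p → ℝ}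
    (hw : w ⬝ᵥ M *ᵥ w ≠ 0) :
    MeasurePreserving (fun x => mahalanobisReflection M w *ᵥ (x - μ) + μ) P P := by
  obtain ⟨C, -, hC⟩ := hP.density
  rw [hC]
  refine MeasurePreserving.withDensity_of_comp_eq ?_ ?_ fun x => ?_
  · exact (measurePreserving_add_right volume μ).comp
      ((measurePreserving_mulVec_of_abs_det_eq_one (abs_det_mahalanobisReflection hw)).comp
        (measurePreserving_sub_right volume μ))
  · have := hP.measurable_generator
    have := measurable_mahalanobisSq μ M
    unfold ellipticalDensity
    fun_prop
  · simp only [ellipticalDensity, mahalanobisSq, add_sub_cancel_right,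
      hP.posDef.mahalanobisReflection_quadratic hw]

lemma integral_dotProduct_pow_four_congr (hP : IsElliptical P μ M g) {u v : Fin p → ℝ}
    (huv : u ⬝ᵥ M *ᵥ u = v ⬝ᵥ M *ᵥ v) :
    ∫ x, (u ⬝ᵥ (x - μ)) ^ 4 ∂P = ∫ x, (v ⬝ᵥ (x - μ)) ^ 4 ∂P := by
  rcases eq_or_ne u v with rfl | h
  · rfl
  have hw := (hP.posDef.dotProduct_mulVec_self_pos (sub_ne_zero.2 h)).ne'
  have hT := hP.measurePreserving_reflection hw
  have hm : AEStronglyMeasurable (fun x => (u ⬝ᵥ (x - μ)) ^ 4)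
      (P.map (fun x => mahalanobisReflection M (u - v) *ᵥ (x - μ) + μ)) :=
    Measurable.aestronglyMeasurable (by fun_prop)
  conv_lhs => rw [← hT.map_eq]
  rw [integral_map hT.measurable.aemeasurable hm]
  simp only [add_sub_cancel_right, hP.posDef.dotProduct_mahalanobisReflection_mulVec huv hw]

/-- Every `u` has the `M`-length of some multiple of one fixed vector, so homogeneity of degree four
determines the moment. The factor `3` is the Gaussian normalization, making `c = κ + 1`. -/
lemma exists_integral_dotProduct_pow_four (hP : IsElliptical P μ M g) (hp : 1 ≤ p) :
    ∃ c : ℝ, ∀ u : Fin p → ℝ, ∫ x, (u ⬝ᵥ (x - μ)) ^ 4 ∂P = 3 * c * (u ⬝ᵥ M *ᵥ u) ^ 2 := by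
  set e : Fin p → ℝ := Pi.single ⟨0, hp⟩ 1 with he
  have he0 : e ≠ 0 := by simp [he]
  have hs := hP.posDef.dotProduct_mulVec_self_pos he0
  set s := e ⬝ᵥ M *ᵥ e
  refine ⟨(∫ x, (e ⬝ᵥ (x - μ)) ^ 4 ∂P) / s ^ 2 / 3, fun u => ?_⟩
  have hu : 0 ≤ u ⬝ᵥ M *ᵥ u := by simpa using hP.posDef.posSemidef.dotProduct_mulVec_nonneg u
  set a := u ⬝ᵥ M *ᵥ u with ha
  have hsq : √(a / s) ^ 2 = a / s := Real.sq_sqrt (by positivity)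
  have h : a = (√(a / s) • e) ⬝ᵥ M *ᵥ (√(a / s) • e) := by
    rw [mulVec_smul, dotProduct_smul, smul_dotProduct, smul_smul, ← sq, hsq, smul_eq_mul]
    change a = a / s * s
    field_simp
  rw [hP.integral_dotProduct_pow_four_congr (ha.symm.trans h)]
  simp only [smul_dotProduct, smul_eq_mul, mul_pow, integral_const_mul]
  rw [pow_mul _ 2 2, hsq]
  field_simp

lemma memLp_dotProduct (hP : IsElliptical P μ M g) (h4 : HasFiniteFourthMoments P)
    (u : Fin p → ℝ) : MemLp (fun x => u ⬝ᵥ (x - μ)) 4 P := by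
  have := hP.isProbabilityMeasure
  simp only [dotProduct]
  exact memLp_finsetSum _ fun i _ => ((h4 i).sub (memLp_const (μ i))).const_mul (u i)

end IsElliptical

instance ENNReal.holderTriple_four_four_two : ENNReal.HolderTriple 4 4 2 where
  inv_add_inv_eq_inv := by
    rw [← two_mul, show (4 : ℝ≥0∞) = 2 * 2 by norm_num, ENNReal.mul_inv (by simp) (by simp),
      ← mul_assoc, ENNReal.mul_inv_cancel (by simp) (by simp), one_mul]

lemma MeasureTheory.MemLp.integrable_sq_mul_sq {α : Type*} [MeasurableSpace α] {m : Measure α}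
    {f h : α → ℝ} (hf : MemLp f 4 m) (hh : MemLp h 4 m) :
    Integrable (fun x => f x ^ 2 * h x ^ 2) m := by
  have : MemLp (fun x => f x * h x) 2 m := hh.mul' hf
  simpa only [mul_pow] using this.integrable_sq

namespace IsElliptical

variable {p : ℕ} {P : Measure (Fin p → ℝ)} {μ : Fin p → ℝ} {M : Matrix (Fin p) (Fin p) ℝ}
  {g : ℝ≥0 → ℝ≥0}

lemma integral_sq_mul_sq_of_pow_four (hP : IsElliptical P μ M g) (h4 : HasFiniteFourthMoments P)
    {c : ℝ} (hc : ∀ u : Fin p → ℝ, ∫ x, (u ⬝ᵥ (x - μ)) ^ 4 ∂P = 3 * c * (u ⬝ᵥ M *ᵥ u) ^ 2)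
    (u v : Fin p → ℝ) :
    ∫ x, (u ⬝ᵥ (x - μ)) ^ 2 * (v ⬝ᵥ (x - μ)) ^ 2 ∂P
      = c * ((u ⬝ᵥ M *ᵥ u) * (v ⬝ᵥ M *ᵥ v) + 2 * (u ⬝ᵥ M *ᵥ v) ^ 2) := by
  have hint (w : Fin p → ℝ) : Integrable (fun x => (w ⬝ᵥ (x - μ)) ^ 4) P := by
    refine ((hP.memLp_dotProduct h4 w).integrable_sq_mul_sq (hP.memLp_dotProduct h4 w)).congr
      (ae_of_all _ fun x => ?_)
    simp only
    ring
  -- Polarization: `12 a² b² = (a + b)⁴ + (a - b)⁴ - 2 (a⁴ + b⁴)`.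
  have key : (fun x => (u ⬝ᵥ (x - μ)) ^ 2 * (v ⬝ᵥ (x - μ)) ^ 2) = fun x =>
      (1 / 12) * ((((u + v) ⬝ᵥ (x - μ)) ^ 4 + ((u - v) ⬝ᵥ (x - μ)) ^ 4)
        - 2 * ((u ⬝ᵥ (x - μ)) ^ 4 + (v ⬝ᵥ (x - μ)) ^ 4)) := by
    ext x
    rw [add_dotProduct, sub_dotProduct]
    ring
  have hadd (w z : Fin p → ℝ) :
      Integrable (fun x => (w ⬝ᵥ (x - μ)) ^ 4 + (z ⬝ᵥ (x - μ)) ^ 4) P := (hint w).add (hint z)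
  rw [key, integral_const_mul, integral_sub (hadd _ _) ((hadd _ _).const_mul _),
    integral_const_mul, integral_add (hint _) (hint _), integral_add (hint _) (hint _),
    hc, hc, hc, hc]
  simp only [mulVec_add, mulVec_sub, add_dotProduct, sub_dotProduct, dotProduct_add,
    dotProduct_sub, dotProduct_mulVec_comm_of_transpose_eq hP.posDef.transpose_eq v u]
  ring

/-- The mixed fourth moments of an elliptical distribution. -/
lemma integral_sq_mul_sq (hP : IsElliptical P μ M g) (h4 : HasFiniteFourthMoments P)
    (hp : 1 ≤ p) (u v : Fin p → ℝ) :
    ∫ x, (u ⬝ᵥ (x - μ)) ^ 2 * (v ⬝ᵥ (x - μ)) ^ 2 ∂P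
      = (ellipticalKurtosis P μ M + 1)
        * ((u ⬝ᵥ M *ᵥ u) * (v ⬝ᵥ M *ᵥ v) + 2 * (u ⬝ᵥ M *ᵥ v) ^ 2) := by
  obtain ⟨c, hc⟩ := hP.exists_integral_dotProduct_pow_four hp
  have h22 := hP.integral_sq_mul_sq_of_pow_four h4 hc
  suffices h : ellipticalKurtosis P μ M + 1 = c by rw [h, h22]
  obtain ⟨B, hB⟩ := hP.posDef.inv.exists_eq_transpose_mul_self
  -- The rows of `B` are orthonormal for `M`, since `B M Bᵀ = 1`; in these coordinates `r²` is a sum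
  -- of squares.
  have hBMB (a b : Fin p) : B a ⬝ᵥ M *ᵥ B b = if a = b then 1 else 0 := by
    have h1 : Bᵀ * (B * M) = 1 := by
      rw [← Matrix.mul_assoc, ← hB,
        nonsing_inv_mul _ ((isUnit_iff_isUnit_det _).1 hP.posDef.isUnit)]
    have h2 : (B * M * Bᵀ) a b = (1 : Matrix _ _ ℝ) a b := by rw [mul_eq_one_comm.1 h1]
    rw [one_apply] at h2
    rw [← h2, Matrix.mul_assoc, mul_apply_eq_vecMul, ← mulVec_transpose]
    simp [dotProduct, mulVec, Matrix.mul_apply, mul_comm]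
  have hmah (x : Fin p → ℝ) : mahalanobisSq μ M x = ∑ a, (B a ⬝ᵥ (x - μ)) ^ 2 := by
    rw [mahalanobisSq, hB, ← mulVec_mulVec, dotProduct_mulVec, vecMul_transpose]
    simp only [dotProduct, mulVec, sq]
  have hr (x : Fin p → ℝ) : generatingVariate μ M x ^ 4
      = ∑ a, ∑ b, (B a ⬝ᵥ (x - μ)) ^ 2 * (B b ⬝ᵥ (x - μ)) ^ 2 := by
    have h0 : 0 ≤ mahalanobisSq μ M x := by rw [hmah]; positivity
    rw [generatingVariate, show 4 = 2 * 2 from rfl, pow_mul, Real.sq_sqrt h0, hmah, sq,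
      Finset.sum_mul_sum]
  have hint (a b : Fin p) :
      Integrable (fun x => (B a ⬝ᵥ (x - μ)) ^ 2 * (B b ⬝ᵥ (x - μ)) ^ 2) P :=
    (hP.memLp_dotProduct h4 _).integrable_sq_mul_sq (hP.memLp_dotProduct h4 _)
  have hr4 : ∫ x, generatingVariate μ M x ^ 4 ∂P = c * (p * (p + 2)) := by
    simp only [hr]
    rw [integral_finsetSum _ fun a _ => integrable_finsetSum _ fun b _ => hint a b]
    simp only [integral_finsetSum _ fun b _ => hint _ b, h22, hBMB]
    -- The sum over `a, b` of `1 + 2 δ_ab` is `p² + 2p`.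
    simp [← Finset.mul_sum, Finset.sum_add_distrib]
    ring
  have hp0 : (0 : ℝ) < p := by exact_mod_cast hp
  rw [ellipticalKurtosis, hr4]
  field_simp
  ring

end IsElliptical

/-- Deviations from the sample mean are unaffected by shifts; `s` and `t` will be the true means. -/
lemma Finset.sum_sub_mean_mul_sub_mean {n : ℕ} (hn : n ≠ 0) (a b : Fin n → ℝ) (s t : ℝ) :
    ∑ i, (a i - 1 / (n : ℝ) * ∑ j, a j) * (b i - 1 / (n : ℝ) * ∑ j, b j)
      = ∑ i, (a i - s) * (b i - t) - (∑ i, (a i - s)) * (∑ i, (b i - t)) / n := by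
  simp only [sub_mul, mul_sub, Finset.sum_sub_distrib, ← Finset.mul_sum, ← Finset.sum_mul,
    Finset.sum_const, Finset.card_univ, Fintype.card_fin, nsmul_eq_mul]
  field_simp
  ring

/-! ### Second moments of the sample covariance of two features -/

section IID

variable {Ω E : Type*} [MeasurableSpace Ω] [MeasurableSpace E] {ν : Measure Ω} {P : Measure E}
  {n : ℕ} {X : Fin n → Ω → E} {f h : E → ℝ}

lemma integral_mul_of_iIndepFun (hlaw : ∀ i, HasLaw (X i) P ν) (hindep : iIndepFun X ν)
    {i a : Fin n} (hia : i ≠ a) (hf : Measurable f) (hh : Measurable h) :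
    ∫ ω, f (X i ω) * h (X a ω) ∂ν = (∫ x, f x ∂P) * ∫ x, h x ∂P := by
  have hind := (hindep.indepFun hia).comp hf hh
  rw [← (hlaw i).integral_comp hf.aestronglyMeasurable,
    ← (hlaw a).integral_comp hh.aestronglyMeasurable]
  exact hind.integral_fun_mul_eq_mul_integral
    (hf.comp_aemeasurable (hlaw i).aemeasurable).aestronglyMeasurable
    (hh.comp_aemeasurable (hlaw a).aemeasurable).aestronglyMeasurable

/-- The indices `a`, `b`, `c` may coincide, so this covers every product in which some index occurs
in only one, centred, factor. -/
lemma integral_mul_eq_zero_of_iIndepFun (hlaw : ∀ i, HasLaw (X i) P ν) (hindep : iIndepFun X ν)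
    {i a b c : Fin n} (hia : i ≠ a) (hib : i ≠ b) (hic : i ≠ c) (hf : Measurable f)
    (hf0 : ∫ x, f x ∂P = 0) {ψ : E × E × E → ℝ} (hψ : Measurable ψ) :
    ∫ ω, f (X i ω) * ψ (X a ω, X b ω, X c ω) ∂ν = 0 := by
  have hX j := (hlaw j).aemeasurable
  have hind := hindep.indepFun_finset₀ {i} {a, b, c} (by simp [hia, hib, hic]) hX
  have hind' : IndepFun (fun ω => f (X i ω)) (fun ω => ψ (X a ω, X b ω, X c ω)) ν :=
    hind.comp (φ := fun z : ({i} : Finset (Fin n)) → E => f (z ⟨i, by simp⟩))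
      (ψ := fun z : ({a, b, c} : Finset (Fin n)) → E =>
        ψ (z ⟨a, by simp⟩, z ⟨b, by simp⟩, z ⟨c, by simp⟩)) (by fun_prop) (by fun_prop)
  rw [hind'.integral_fun_mul_eq_mul_integral
    (hf.comp_aemeasurable (hX i)).aestronglyMeasurable
    (hψ.comp_aemeasurable ((hX a).prodMk ((hX b).prodMk (hX c)))).aestronglyMeasurable]
  have h0 : ∫ ω, f (X i ω) ∂ν = 0 := by
    rw [← hf0]
    exact (hlaw i).integral_comp hf.aestronglyMeasurable
  rw [h0, zero_mul]

/-- The centred products `f (X i) h (X l)` indexed by `(i, l)`. -/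
noncomputable def centeredProd (P : Measure E) (f h : E → ℝ) (X : Fin n → Ω → E)
    (q : Fin n × Fin n) (ω : Ω) : ℝ :=
  f (X q.1 ω) * h (X q.2 ω) - if q.1 = q.2 then ∫ x, f x * h x ∂P else 0

lemma memLp_centeredProd [IsProbabilityMeasure ν] (hlaw : ∀ i, HasLaw (X i) P ν)
    (hf4 : MemLp f 4 P) (hh4 : MemLp h 4 P) (q : Fin n × Fin n) :
    MemLp (centeredProd P f h X q) 2 ν := by
  have hc (φ : E → ℝ) (hφ : MemLp φ 4 P) (i : Fin n) : MemLp (fun ω => φ (X i ω)) 4 ν := by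
    have := (hlaw i).map_eq ▸ hφ
    exact this.comp_of_map (hlaw i).aemeasurable
  exact ((hc h hh4 q.2).mul' (hc f hf4 q.1)).sub (memLp_const _)

lemma integral_centeredProd_diag_mul [IsProbabilityMeasure P] (hlaw : ∀ i, HasLaw (X i) P ν)
    (hindep : iIndepFun X ν) (hf : Measurable f) (hh : Measurable h) (hf4 : MemLp f 4 P)
    (hh4 : MemLp h 4 P) (hf0 : ∫ x, f x ∂P = 0) (hh0 : ∫ x, h x ∂P = 0) (i : Fin n)
    (r : Fin n × Fin n) :
    ∫ ω, centeredProd P f h X (i, i) ω * centeredProd P f h X r ω ∂ν =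
      if r = (i, i) then (∫ x, f x ^ 2 * h x ^ 2 ∂P) - (∫ x, f x * h x ∂P) ^ 2 else 0 := by
  obtain ⟨a, b⟩ := r
  simp only [centeredProd, if_true]
  set m := ∫ x, f x * h x ∂P with hm
  have hfh : Integrable (fun x => f x * h x) P :=
    MemLp.integrable (q := 2) (by norm_num) (hh4.mul' hf4)
  have hm0 : ∫ x, (f x * h x - m) ∂P = 0 := by
    rw [integral_sub hfh (integrable_const _), ← hm]
    simp
  by_cases hab : a = b
  · subst hab
    simp only [if_true]
    by_cases hai : a = i
    · subst hai
      simp only [if_true]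
      have hφ : Measurable fun x => (f x * h x - m) * (f x * h x - m) := by fun_prop
      refine ((hlaw a).integral_comp hφ.aestronglyMeasurable).trans ?_
      have hexp : (fun x => (f x * h x - m) * (f x * h x - m))
          = fun x => f x ^ 2 * h x ^ 2 - (2 * m * (f x * h x) - m ^ 2) := by
        ext x
        ring
      have hint : Integrable (fun x => 2 * m * (f x * h x) - m ^ 2) P :=
        (hfh.const_mul _).sub (integrable_const _)
      rw [hexp, integral_sub (hf4.integrable_sq_mul_sq hh4) hint,
        integral_sub (hfh.const_mul _) (integrable_const _), integral_const_mul, ← hm]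
      simp
      ring
    · rw [if_neg (by simp [hai])]
      have := integral_mul_of_iIndepFun (f := fun x => f x * h x - m)
        (h := fun x => f x * h x - m) hlaw hindep (Ne.symm hai) (by fun_prop) (by fun_prop)
      rw [this, hm0, zero_mul]
  · have hne : (a, b) ≠ (i, i) := by simp; grind
    simp only [hab, hne, if_false, sub_zero]
    by_cases hai : a = i
    · subst hai
      have := integral_mul_eq_zero_of_iIndepFun hlaw hindep (Ne.symm hab) (Ne.symm hab)
        (Ne.symm hab) hh hh0 (ψ := fun z => (f z.1 * h z.1 - m) * f z.1) (by fun_prop)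
      rw [← this]
      congr 1 with ω
      ring
    · have := integral_mul_eq_zero_of_iIndepFun hlaw hindep hai hai hab hf hf0
        (ψ := fun z => (f z.1 * h z.1 - m) * h z.2.2) (by fun_prop)
      rw [← this]
      congr 1 with ω
      ring

/-- Off the diagonal, an index occurring only once kills the expectation, leaving `r = q` and `r =
q.swap`. For diagonal `q` these agree, so the swap term is set to zero there. -/
lemma integral_centeredProd_mul [IsProbabilityMeasure P] (hlaw : ∀ i, HasLaw (X i) P ν)
    (hindep : iIndepFun X ν) (hf : Measurable f) (hh : Measurable h) (hf4 : MemLp f 4 P)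
    (hh4 : MemLp h 4 P) (hf0 : ∫ x, f x ∂P = 0) (hh0 : ∫ x, h x ∂P = 0) (q r : Fin n × Fin n) :
    ∫ ω, centeredProd P f h X q ω * centeredProd P f h X r ω ∂ν =
      (if r = q then (if q.1 = q.2 then
          (∫ x, f x ^ 2 * h x ^ 2 ∂P) - (∫ x, f x * h x ∂P) ^ 2
        else (∫ x, f x ^ 2 ∂P) * ∫ x, h x ^ 2 ∂P) else 0)
      + if r = q.swap then (if q.1 = q.2 then 0 else (∫ x, f x * h x ∂P) ^ 2) else 0 := by
  obtain ⟨i, l⟩ := q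
  by_cases hil : i = l
  · subst hil
    rw [integral_centeredProd_diag_mul hlaw hindep hf hh hf4 hh4 hf0 hh0]
    simp
  obtain ⟨a, b⟩ := r
  by_cases hab : a = b
  · subst hab
    simp_rw [mul_comm (centeredProd P f h X (i, l) _)]
    rw [integral_centeredProd_diag_mul hlaw hindep hf hh hf4 hh4 hf0 hh0]
    have h1 : (i, l) ≠ (a, a) := by simp; grind
    have h2 : (a, a) ≠ (i, l) := h1.symm
    have h3 : (a, a) ≠ (l, i) := by simp; grind
    simp [h1, h2, h3]
  simp only [centeredProd, hil, hab, if_false, sub_zero, Prod.swap_prod_mk, Prod.mk.injEq]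
  by_cases hai : a = i
  · subst hai
    by_cases hbl : b = l
    · subst hbl
      have := integral_mul_of_iIndepFun (f := fun x => f x ^ 2) (h := fun x => h x ^ 2)
        hlaw hindep hil (by fun_prop) (by fun_prop)
      simp only [hab, and_self, if_true, false_and, if_false, add_zero]
      rw [← this]
      congr 1 with ω
      ring
    · have := integral_mul_eq_zero_of_iIndepFun hlaw hindep (Ne.symm hil) (Ne.symm hil)
        (Ne.symm hbl) hh hh0 (ψ := fun z => f z.1 * f z.1 * h z.2.2) (by fun_prop)
      simp only [hbl, hil, and_false, false_and, if_false, add_zero]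
      rw [← this]
      congr 1 with ω
      ring
  · by_cases hbi : b = i
    · subst hbi
      by_cases hal : a = l
      · subst hal
        have := integral_mul_of_iIndepFun (f := fun x => f x * h x) (h := fun x => f x * h x)
          hlaw hindep hil (by fun_prop) (by fun_prop)
        simp only [hab, and_self, if_true, false_and, if_false, zero_add]
        rw [sq, ← this]
        congr 1 with ω
        ring
      · have := integral_mul_eq_zero_of_iIndepFun hlaw hindep (Ne.symm hil) (Ne.symm hil)
          (Ne.symm hal) hh hh0 (ψ := fun z => f z.1 * h z.1 * f z.2.2) (by fun_prop)
        simp only [hai, hal, false_and, if_false, add_zero]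
        rw [← this]
        congr 1 with ω
        ring
    · have := integral_mul_eq_zero_of_iIndepFun hlaw hindep hil (Ne.symm hai) (Ne.symm hbi)
        hf hf0 (ψ := fun z => h z.1 * f z.2.1 * h z.2.2) (by fun_prop)
      simp only [hai, hbi, and_false, false_and, if_false, add_zero]
      rw [← this]
      congr 1 with ω
      ring

lemma integral_sq_sum_mul {ι : Type*} [Fintype ι] {D : ι → Ω → ℝ} (hD : ∀ q, MemLp (D q) 2 ν)
    (c : ι → ℝ) :
    ∫ ω, (∑ q, c q * D q ω) ^ 2 ∂ν = ∑ q, ∑ r, c q * c r * ∫ ω, D q ω * D r ω ∂ν := by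
  have hint q r : Integrable (fun ω => c q * c r * (D q ω * D r ω)) ν :=
    ((hD q).integrable_mul (hD r)).const_mul _
  have hexp : (fun ω => (∑ q, c q * D q ω) ^ 2)
      = fun ω => ∑ q, ∑ r, c q * c r * (D q ω * D r ω) := by
    ext ω
    rw [sq, Finset.sum_mul_sum]
    refine Finset.sum_congr rfl fun q _ => Finset.sum_congr rfl fun r _ => ?_
    ring
  rw [hexp, integral_finsetSum _ fun q _ => integrable_finsetSum _ fun r _ => hint q r]
  simp only [integral_finsetSum _ fun r _ => hint _ r, integral_const_mul]

/-- The coefficients of the centred products in the error of the unbiased sample covariance. -/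
noncomputable def centeredProdCoeff (n : ℕ) (q : Fin n × Fin n) : ℝ :=
  if q.1 = q.2 then 1 / (n : ℝ) else -(1 / ((n : ℝ) * (n - 1)))

-- The sum of products contributes `1 / (n - 1)` to diagonal pairs, the product of sums `-1 / (n (n
-- - 1))` to all pairs; on the diagonal these add up to `1 / n`.
omit [MeasurableSpace Ω] in
lemma sum_centeredProdCoeff_mul (hn : 2 ≤ n) (ω : Ω) :
    ∑ q, centeredProdCoeff n q * centeredProd P f h X q ω
      = 1 / ((n : ℝ) - 1) * (∑ i, f (X i ω) * h (X i ω)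
          - (∑ i, f (X i ω)) * (∑ i, h (X i ω)) / n) - ∫ x, f x * h x ∂P := by
  have hn2 : (2 : ℝ) ≤ n := by exact_mod_cast hn
  have hn0 : (n : ℝ) ≠ 0 := by linarith
  have hn1 : (n : ℝ) - 1 ≠ 0 := by linarith
  have hsplit (q : Fin n × Fin n) : centeredProdCoeff n q * centeredProd P f h X q ω
      = (if q.1 = q.2 then 1 / ((n : ℝ) - 1) * (f (X q.1 ω) * h (X q.2 ω))
          - 1 / (n : ℝ) * ∫ x, f x * h x ∂P else 0)
        - 1 / ((n : ℝ) * (n - 1)) * (f (X q.1 ω) * h (X q.2 ω)) := by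
    unfold centeredProdCoeff centeredProd
    split_ifs
    · field_simp
      ring
    · ring
  simp only [hsplit, Finset.sum_sub_distrib, Fintype.sum_prod_type, Finset.sum_ite_eq,
    Finset.mem_univ, if_true, ← Finset.mul_sum, ← Finset.sum_mul, Finset.sum_const,
    Finset.card_univ, Fintype.card_fin, nsmul_eq_mul]
  field_simp
  ring

/-- The variance of the unbiased sample covariance of the two features `f` and `h`. -/
lemma integral_sq_sum_centeredProd [IsProbabilityMeasure ν] [IsProbabilityMeasure P]
    (hlaw : ∀ i, HasLaw (X i) P ν)
    (hindep : iIndepFun X ν) (hf : Measurable f) (hh : Measurable h) (hf4 : MemLp f 4 P)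
    (hh4 : MemLp h 4 P) (hf0 : ∫ x, f x ∂P = 0) (hh0 : ∫ x, h x ∂P = 0) (hn : 2 ≤ n) :
    ∫ ω, (∑ q, centeredProdCoeff n q * centeredProd P f h X q ω) ^ 2 ∂ν
      = ((∫ x, f x ^ 2 * h x ^ 2 ∂P) - (∫ x, f x * h x ∂P) ^ 2) / n
        + ((∫ x, f x ^ 2 ∂P) * (∫ x, h x ^ 2 ∂P) + (∫ x, f x * h x ∂P) ^ 2)
          / ((n : ℝ) * (n - 1)) := by
  have hn2 : (2 : ℝ) ≤ n := by exact_mod_cast hn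
  have hn0 : (n : ℝ) ≠ 0 := by linarith
  have hn1 : (n : ℝ) - 1 ≠ 0 := by linarith
  rw [integral_sq_sum_mul fun q => memLp_centeredProd hlaw hf4 hh4 q]
  simp only [integral_centeredProd_mul hlaw hindep hf hh hf4 hh4 hf0 hh0, mul_add,
    Finset.sum_add_distrib, mul_ite, mul_zero, Finset.sum_ite_eq', Finset.mem_univ, if_true]
  generalize (∫ x, f x ^ 2 * h x ^ 2 ∂P) - (∫ x, f x * h x ∂P) ^ 2 = e
  generalize (∫ x, f x ^ 2 ∂P) * (∫ x, h x ^ 2 ∂P) = s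
  generalize (∫ x, f x * h x ∂P) ^ 2 = t
  rw [← Finset.sum_add_distrib]
  -- Writing the summand as a constant plus a diagonal correction leaves only the counts `n²` and
  -- `n`.
  have hterm (q : Fin n × Fin n) :
      ((if q.1 = q.2 then centeredProdCoeff n q * centeredProdCoeff n q * e
          else centeredProdCoeff n q * centeredProdCoeff n q * s)
        + if q.1 = q.2 then 0 else centeredProdCoeff n q * centeredProdCoeff n q.swap * t)
      = (if q.1 = q.2 then e / n ^ 2 - (s + t) / (n * (n - 1)) ^ 2 else 0)
        + (s + t) / (n * (n - 1)) ^ 2 := by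
    by_cases hq : q.1 = q.2
    · simp only [centeredProdCoeff, hq, if_true]
      field_simp
      ring
    · simp only [centeredProdCoeff, hq, Ne.symm hq, if_false, Prod.fst_swap, Prod.snd_swap]
      field_simp
      ring
  simp only [hterm, Finset.sum_add_distrib, Fintype.sum_prod_type, Finset.sum_ite_eq,
    Finset.mem_univ, if_true, Finset.sum_const, Finset.card_univ, Fintype.card_fin, nsmul_eq_mul,
    Fintype.card_prod, Nat.cast_mul]
  field_simp
  ring

end IID

-- Entries of the sample covariance matrix and the mean squared error

attribute [local instance] Matrix.frobeniusNormedAddCommGroup in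
lemma frobNorm_sq {p : ℕ} (A : Matrix (Fin p) (Fin p) ℝ) :
    frobNorm A ^ 2 = ∑ i, ∑ j, A i j ^ 2 := by
  rw [frobNorm, frobenius_norm_def, ← Real.sqrt_eq_rpow, Real.sq_sqrt (by positivity)]
  simp

lemma sampleCov_apply {n p : ℕ} (x : Fin n → Fin p → ℝ) (j k : Fin p) :
    sampleCov x j k = 1 / ((n : ℝ) - 1) *
      ∑ i, (x i j - 1 / (n : ℝ) * ∑ l, x l j) * (x i k - 1 / (n : ℝ) * ∑ l, x l k) := by
  simp [sampleCov, sampleMean, Matrix.sum_apply, vecMulVec_apply]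

namespace IsElliptical

variable {p : ℕ} {P : Measure (Fin p → ℝ)} {μ : Fin p → ℝ} {M : Matrix (Fin p) (Fin p) ℝ}
  {g : ℝ≥0 → ℝ≥0}

lemma integral_coord_sub_mean (hP : IsElliptical P μ M g) (j : Fin p) :
    ∫ x, (x j - μ j) ∂P = 0 := by
  have := hP.isProbabilityMeasure
  rw [integral_sub ((hP.second_moments j).integrable (by norm_num)) (integrable_const _), hP.mean]
  simp

lemma memLp_coord_sub_mean (hP : IsElliptical P μ M g) (h4 : HasFiniteFourthMoments P)
    (j : Fin p) : MemLp (fun x => x j - μ j) 4 P := by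
  simpa using hP.memLp_dotProduct h4 (Pi.single j 1)

lemma integral_coord_sq_mul_sq (hP : IsElliptical P μ M g) (h4 : HasFiniteFourthMoments P)
    (hp : 1 ≤ p) (j k : Fin p) :
    ∫ x, (x j - μ j) ^ 2 * (x k - μ k) ^ 2 ∂P
      = (ellipticalKurtosis P μ M + 1) * (M j j * M k k + 2 * M j k ^ 2) := by
  simpa using hP.integral_sq_mul_sq h4 hp (Pi.single j 1) (Pi.single k 1)

variable {Ω : Type*} [MeasurableSpace Ω] {ν : Measure Ω} {n : ℕ} {X : Fin n → Ω → Fin p → ℝ}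

omit [MeasurableSpace Ω] in
lemma sampleCov_sub_apply (hP : IsElliptical P μ M g) (hn : 2 ≤ n) (ω : Ω) (j k : Fin p) :
    sampleCov (fun i => X i ω) j k - M j k = ∑ q, centeredProdCoeff n q
      * centeredProd P (fun x => x j - μ j) (fun x => x k - μ k) X q ω := by
  rw [sum_centeredProdCoeff_mul hn, sampleCov_apply,
    Finset.sum_sub_mean_mul_sub_mean (by lia) _ _ (μ j) (μ k), hP.covariance]

lemma memLp_sampleCov_sub_apply [IsProbabilityMeasure ν] (hP : IsElliptical P μ M g)
    (h4 : HasFiniteFourthMoments P) (hn : 2 ≤ n) (hlaw : ∀ i, HasLaw (X i) P ν) (j k : Fin p) :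
    MemLp (fun ω => sampleCov (fun i => X i ω) j k - M j k) 2 ν := by
  simp only [hP.sampleCov_sub_apply hn]
  exact memLp_finsetSum _ fun q _ => (memLp_centeredProd hlaw (hP.memLp_coord_sub_mean h4 j)
    (hP.memLp_coord_sub_mean h4 k) q).const_mul _

/-- The variance of an entry of the sample covariance matrix. -/
lemma integral_sampleCov_sub_sq [IsProbabilityMeasure ν] (hP : IsElliptical P μ M g)
    (h4 : HasFiniteFourthMoments P) (hn : 2 ≤ n) (hp : 1 ≤ p) (hlaw : ∀ i, HasLaw (X i) P ν)
    (hindep : iIndepFun X ν) (j k : Fin p) :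
    ∫ ω, (sampleCov (fun i => X i ω) j k - M j k) ^ 2 ∂ν
      = (1 / ((n : ℝ) - 1) + ellipticalKurtosis P μ M / n) * (M j j * M k k)
        + (1 / ((n : ℝ) - 1) + 2 * ellipticalKurtosis P μ M / n) * M j k ^ 2 := by
  have := hP.isProbabilityMeasure
  have hn2 : (2 : ℝ) ≤ n := by exact_mod_cast hn
  have hn0 : (n : ℝ) ≠ 0 := by linarith
  have hn1 : (n : ℝ) - 1 ≠ 0 := by linarith
  simp only [hP.sampleCov_sub_apply hn]
  rw [integral_sq_sum_centeredProd hlaw hindep (by fun_prop) (by fun_prop)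
    (hP.memLp_coord_sub_mean h4 j) (hP.memLp_coord_sub_mean h4 k)
    (hP.integral_coord_sub_mean j) (hP.integral_coord_sub_mean k) hn,
    hP.integral_coord_sq_mul_sq h4 hp, hP.covariance]
  simp only [sq (_ - _), hP.covariance]
  field_simp
  ring

end IsElliptical

lemma Matrix.PosDef.sum_sq_eq_trace_sq {p : ℕ} {M : Matrix (Fin p) (Fin p) ℝ} (hM : M.PosDef) :
    ∑ j, ∑ k, M j k ^ 2 = (M ^ 2).trace := by
  simp only [Matrix.trace, diag_apply, sq, Matrix.mul_apply]
  refine Finset.sum_congr rfl fun j _ => Finset.sum_congr rfl fun k _ => ?_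
  rw [← congrFun₂ hM.transpose_eq j k, transpose_apply]

theorem lemma1 {Ω : Type*} [MeasurableSpace Ω] (ν : Measure Ω) [IsProbabilityMeasure ν]
    {n p : ℕ} (hn : 2 ≤ n) (hp : 1 ≤ p)
    (P : Measure (Fin p → ℝ)) (μ : Fin p → ℝ) (M : Matrix (Fin p) (Fin p) ℝ) (g : ℝ≥0 → ℝ≥0)
    (hP : IsElliptical P μ M g) (h4 : HasFiniteFourthMoments P)
    (X : Fin n → Ω → Fin p → ℝ)
    (hlaw : ∀ i, HasLaw (X i) P ν) (hindep : iIndepFun X ν)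
    (S : Ω → Matrix (Fin p) (Fin p) ℝ) (hS : S = fun ω => sampleCov (fun i => X i ω))
    (κ : ℝ) (hκ : κ = ellipticalKurtosis P μ M) (γ : ℝ) (hγ : γ = sphericity M) :
    Integrable (fun ω => frobNorm (S ω - M) ^ 2) ν ∧
    MSE ν S M = (1 / ((n : ℝ) - 1) + κ / n) * M.trace ^ 2
      + (1 / ((n : ℝ) - 1) + 2 * κ / n) * (M ^ 2).trace ∧
    NMSE ν S M = (1 + p / γ) * (1 / ((n : ℝ) - 1) + κ / n) + κ / n := by
  have hn2 : (2 : ℝ) ≤ n := by exact_mod_cast hn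
  have hn0 : (n : ℝ) ≠ 0 := by linarith
  have hn1 : (n : ℝ) - 1 ≠ 0 := by linarith
  have hint (j k : Fin p) : Integrable (fun ω => (S ω j k - M j k) ^ 2) ν := by
    subst hS
    exact (hP.memLp_sampleCov_sub_apply h4 hn hlaw j k).integrable_sq
  have hmse : MSE ν S M = (1 / ((n : ℝ) - 1) + κ / n) * M.trace ^ 2
      + (1 / ((n : ℝ) - 1) + 2 * κ / n) * (M ^ 2).trace := by
    simp only [MSE, frobNorm_sq, Matrix.sub_apply]
    rw [integral_finsetSum _ fun j _ => integrable_finsetSum _ fun k _ => hint j k]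
    simp only [integral_finsetSum _ fun k _ => hint _ k]
    subst hS hκ
    simp only [hP.integral_sampleCov_sub_sq h4 hn hp hlaw hindep, Finset.sum_add_distrib,
      ← Finset.mul_sum, hP.posDef.sum_sq_eq_trace_sq, ← Finset.sum_mul]
    simp only [Matrix.trace, diag_apply, sq (Finset.sum _ _)]
  refine ⟨?_, hmse, ?_⟩
  · simp only [frobNorm_sq, Matrix.sub_apply]
    exact integrable_finsetSum _ fun j _ => integrable_finsetSum _ fun k _ => hint j k
  · have : Nonempty (Fin p) := ⟨⟨0, hp⟩⟩
    have hp0 : (p : ℝ) ≠ 0 := by exact_mod_cast (by lia : p ≠ 0)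
    have htr : M.trace ≠ 0 := hP.posDef.trace_pos.ne'
    -- One positive diagonal entry of `M` bounds the sum of squares away from zero.
    have htr2 : (M ^ 2).trace ≠ 0 := by
      rw [← hP.posDef.sum_sq_eq_trace_sq]
      refine (lt_of_lt_of_le (pow_pos (hP.posDef.diag_pos (i := ⟨0, hp⟩)) 2) ?_).ne'
      refine (Finset.single_le_sum (f := fun k => M ⟨0, hp⟩ k ^ 2) (fun _ _ => sq_nonneg _)
        (Finset.mem_univ _)).trans ?_
      exact Finset.single_le_sum (f := fun j => ∑ k, M j k ^ 2) (fun _ _ => by positivity)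
        (Finset.mem_univ _)
    rw [NMSE, hmse, frobNorm_sq, hP.posDef.sum_sq_eq_trace_sq, hγ, sphericity]
    field_simp
    ring
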